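/- Let $K$ be a field, let $n\ge 2$ and $p\ge 2$ be natural numbers, and let $\mathcal T_n$ be the Temperley–Lieb algebra over $K$ with loop parameter $p$, that is, the unital associative $K$-algebra generated by $h_1,\dots,h_{n-1}$ subject to $$h_ih_j=h_jh_i\ (i-j\ge 2),\qquad h_ih_{i\pm1}h_i=h_i,\qquad h_ih_i=p\,h_i .$$ For $1\le i\le n-1$ and $0\le k\le i$ put $h_{i,k}=h_ih_{i-1}\cdots h_{i-k+1}$ (so $h_{i,0}=1$). Let $\mathcal J_n$ be the family of Jones normal forms $h_{1,k_1}h_{2,k_2}\cdots h_{n-1,k_{n-1}}$, indexed by the sequences $(k_1,\dots,k_{n-1})$ with $0\le k_i\le i$ for all $i$ and with $i-k_i<j-k_j$ whenever $i<j$ and $k_i,k_j>0$. Let $E_p$ be the $1\times p^2$ matrix with $E_p(1,(i-1)p+j)=\delta(i,j)$ for $1\le i,j\le p$, let $E_p'$ be its transpose, and assign to $h_k$ the $p^n\times p^n$ 0-1 matrix $I_{p^{n-k-1}}\otimes E_p'E_p\otimes I_{p^{k-1}}$, where $\otimes$ is the Kronecker product. Identify a 0-1 matrix $A$ with the binary relation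 $\{(x,y): A(x,y)=1\}$, and assign to each Jones normal form the 0-1 matrix over $K$ whose binary relation is the composite of the relations of its letters $h_i$, in the order of the letters (the identity relation for the empty word). Then: 1. $\mathcal J_n$ is a basis of $\mathcal T_n$: the family of Jones normal forms is linearly independent and spans $\mathcal T_n$. 2. The family of 0-1 matrices assigned to the Jones normal forms is linearly independent over $K$. 3. There is a unique homomorphism $\rho$ of unital $K$-algebras from $\mathcal T_n$ to the $p^n\times p^n$ matrices over $K$ that sends each $h_k$ to its assigned matrix (Brauer's representation). It sends every Jones normal form to the 0-1 matrix assigned to it, and it is faithful, i.e. injective. -/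

import Mathlib

open scoped Kronecker

namespace TemperleyLieb

/-! ### Temperley–Lieb algebras

The generators `h₁, …, h_{n-1}` are indexed by `Fin (n - 1)`: the index `i` stands for `h_{i+1}`. -/

/-- Defining relations of the Temperley–Lieb algebra on `n` strands with loop parameter `δ`. -/
inductive Rel (K : Type*) [Field K] (n : ℕ) (δ : K) :
    FreeAlgebra K (Fin (n - 1)) → FreeAlgebra K (Fin (n - 1)) → Prop
  | comm (i j : Fin (n - 1)) (hij : (j : ℕ) + 2 ≤ (i : ℕ)) :
      Rel K n δ (FreeAlgebra.ι K i * FreeAlgebra.ι K j) (FreeAlgebra.ι K j * FreeAlgebra.ι K i)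
  | braid (i j : Fin (n - 1)) (hij : (j : ℕ) = (i : ℕ) + 1 ∨ (i : ℕ) = (j : ℕ) + 1) :
      Rel K n δ (FreeAlgebra.ι K i * FreeAlgebra.ι K j * FreeAlgebra.ι K i) (FreeAlgebra.ι K i)
  | sq (i : Fin (n - 1)) :
      Rel K n δ (FreeAlgebra.ι K i * FreeAlgebra.ι K i) (δ • FreeAlgebra.ι K i)

/-- The Temperley–Lieb algebra `𝒯ₙ` over `K` with loop parameter `δ`: the unital associative
`K`-algebra generated by `h₁, …, h_{n-1}` subject to the relations `Rel`. -/
abbrev Alg (K : Type*) [Field K] (n : ℕ) (δ : K) : Type _ := RingQuot (Rel K n δ)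

/-- The generator `h_{i+1}` of the Temperley–Lieb algebra. -/
def gen (K : Type*) [Field K] (n : ℕ) (δ : K) (i : Fin (n - 1)) : Alg K n δ :=
  RingQuot.mkAlgHom K (Rel K n δ) (FreeAlgebra.ι K i)

/-! ### Jones normal forms -/

/-- The block `h_{i,k} = h_i h_{i-1} ⋯ h_{i-k+1}` (empty for `k = 0`), as a word in the generators;
in this definition `i` is counted from `0`. -/
def blockWord {m : ℕ} (i : Fin m) : ℕ → List (Fin m)
  | 0 => []
  | k + 1 => blockWord i k ++ [⟨(i : ℕ) - k, lt_of_le_of_lt (Nat.sub_le _ _) i.isLt⟩]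

/-- The sequences `k₁ … k_{n-1}` (entry `k i` stands for `k_{i+1}`) that describe the Jones normal
forms: `0 ≤ k_i ≤ i`, and `i - k_i < j - k_j` whenever `i < j` and `k_i, k_j > 0`. -/
def NormalSeq (n : ℕ) : Type :=
  {k : Fin (n - 1) → ℕ //
    (∀ i, k i ≤ (i : ℕ) + 1) ∧
      ∀ i j, i < j → 0 < k i → 0 < k j → ((i : ℕ) : ℤ) - (k i : ℤ) < ((j : ℕ) : ℤ) - (k j : ℤ)}

/-- The Jones normal form `h_{1,k₁} ⋯ h_{n-1,k_{n-1}}`, as a word in the generators. -/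
def normalWord {n : ℕ} (k : NormalSeq n) : List (Fin (n - 1)) :=
  (List.ofFn fun i => blockWord i (k.1 i)).flatten

/-- The element of the Temperley–Lieb algebra denoted by a Jones normal form. -/
def normalForm (K : Type*) [Field K] (δ : K) {n : ℕ} (k : NormalSeq n) : Alg K n δ :=
  ((normalWord k).map (gen K n δ)).prod

/-! ### Brauer's matrices -/

/-- Kronecker product of matrices with rows and columns numbered lexicographically. -/
def kron {R : Type*} [CommRing R] {a b c d : ℕ} (A : Matrix (Fin a) (Fin b) R)
    (B : Matrix (Fin c) (Fin d) R) : Matrix (Fin (a * c)) (Fin (b * d)) R :=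
  (A ⊗ₖ B).submatrix finProdFinEquiv.symm finProdFinEquiv.symm

/-- The `1 × p²` matrix `E_p`: counting from `0`, its entry in column `i * p + j` is `δ(i, j)`. -/
def E (R : Type*) [CommRing R] (p : ℕ) : Matrix (Fin 1) (Fin (p * p)) R :=
  Matrix.of fun _ c => if (finProdFinEquiv.symm c).1 = (finProdFinEquiv.symm c).2 then 1 else 0

theorem size_eq (p : ℕ) {n : ℕ} (i : Fin (n - 1)) :
    p ^ (n - ((i : ℕ) + 1) - 1) * (p * p) * p ^ (i : ℕ) = p ^ n := by
  rw [← pow_two, ← pow_add, ← pow_add]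
  congr 1
  have := i.isLt
  omega

/-- The `pⁿ × pⁿ` matrix `I_{p^{n-k-1}} ⊗ E_p' E_p ⊗ I_{p^{k-1}}` assigned to `h_k`,
where `k = i + 1`. -/
def brauerMatrix (R : Type*) [CommRing R] (p n : ℕ) (i : Fin (n - 1)) :
    Matrix (Fin (p ^ n)) (Fin (p ^ n)) R :=
  (kron
    (kron (1 : Matrix (Fin (p ^ (n - ((i : ℕ) + 1) - 1))) (Fin (p ^ (n - ((i : ℕ) + 1) - 1))) R)
      ((E R p).transpose * E R p))
    (1 : Matrix (Fin (p ^ (i : ℕ))) (Fin (p ^ (i : ℕ))) R)).submatrix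
      (Fin.cast (size_eq p i).symm) (Fin.cast (size_eq p i).symm)

/-- The binary relation identified with a 0-1 matrix. -/
def relOf {R ι : Type*} [One R] (A : Matrix ι ι R) : SetRel ι ι := {x | A x.1 x.2 = 1}

/-- The composite of a list of binary relations (the identity for the empty list). -/
def relProd {ι : Type*} : List (SetRel ι ι) → SetRel ι ι
  | [] => SetRel.id
  | r :: l => r.comp (relProd l)

/-- The 0-1 matrix assigned to a Jones normal form: compose the binary relations
of the matrices assigned to its letters, and take the 0-1 matrix of the composite. -/
noncomputable def normalMatrix (K : Type*) [Field K] (p : ℕ) {n : ℕ} (k : NormalSeq n) :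
    Matrix (Fin (p ^ n)) (Fin (p ^ n)) K :=
  open Classical in
  Matrix.of fun x y =>
    if (x, y) ∈ relProd ((normalWord k).map fun i => relOf (brauerMatrix K p n i)) then 1 else 0

end TemperleyLieb

/-! A Jones normal form is a planar diagram: read around its boundary, top points left to right and
then bottom points right to left, it is a noncrossing matching of `2 * n` points on a line. The
proof works with this matching through base `p` digits, which are labels of the boundary points.

Matrices: the block with index `m` (from zero) introduces a new strand, an adjacent pair inserted in
the middle of the line, and each letter of the block shifts that pair one place to the right
(`matchRel_cup`). No closed loop arises, so intermediate points are unique (`cup_unique`). Hence the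
product of Brauer's matrices and the composite of their relations are given by the same 0-1 relation
`MatchRel` (`represents_natWord`).

Independence: give the letter `u j` the sign `(-1) ^ (u j + j)`. Matched points have positions of
opposite parity, so equal labels cancel, and the partial sums of a compatible word are bounded in
absolute value by the number of open arcs. The word `openWord` attains this bound, which makes the
matrices triangular for the pointwise order of Dyck paths (`Compat.abs_height_le`). The Dyck path
determines the normal sequence, because the last block is visible as the first peak in the second
half of the line (`IsNormal.eq_of_openWord_eq`). Two letters suffice, hence `2 ≤ p`.

Spanning: a normal word times a generator is a scalar times a word that is no longer, or is a normal
word (`IsTL.wordProd_natWord_mul`); induction on length finishes.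

Brauer's matrices satisfy the defining relations, so `ρ` exists. It sends a spanning family to an
independent one; therefore that family is a basis and `ρ` is injective. -/

namespace TemperleyLieb

/-! ### Digits -/

/-- The digit of `x` of weight `p ^ j` in base `p`. -/
def digit (p x j : ℕ) : ℕ := x / p ^ j % p

theorem mod_pow_eq_iff (p x y s : ℕ) :
    x % p ^ s = y % p ^ s ↔ ∀ j < s, digit p x j = digit p y j := by
  constructor
  · intro h j hj
    have key : ∀ z, digit p z j = (z % p ^ s) / p ^ j % p := by
      intro z
      obtain ⟨t, rfl⟩ : ∃ t, s = j + 1 + t := ⟨s - (j + 1), by omega⟩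
      rw [digit, pow_add, pow_succ, mul_assoc, Nat.mod_mul_right_div_self, Nat.mod_mul_right_mod]
    rw [key, key, h]
  · intro h
    induction s with
    | zero => simp [Nat.mod_one]
    | succ s ih =>
      rw [Nat.mod_pow_succ, Nat.mod_pow_succ, ih fun j hj => h j (by omega)]
      have := h s (by omega)
      rw [digit, digit] at this
      rw [this]

theorem eq_of_digit {p n x y : ℕ} (hx : x < p ^ n) (hy : y < p ^ n)
    (h : ∀ j < n, digit p x j = digit p y j) : x = y := by
  have := (mod_pow_eq_iff p x y n).2 h
  rwa [Nat.mod_eq_of_lt hx, Nat.mod_eq_of_lt hy] at this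

theorem digit_div (p x s j : ℕ) : digit p (x / p ^ s) j = digit p x (s + j) := by
  rw [digit, digit, Nat.div_div_eq_div_mul, pow_add]

theorem digit_eq_zero {p n x : ℕ} (hx : x < p ^ n) {j : ℕ} (hj : n ≤ j) : digit p x j = 0 := by
  rcases Nat.eq_zero_or_pos p with rfl | hp
  · rcases Nat.eq_zero_or_pos n with rfl | hn
    · have : x = 0 := by simpa using hx
      simp [digit, this]
    · simp [zero_pow hn.ne'] at hx
  · rw [digit, Nat.div_eq_of_lt (hx.trans_le (Nat.pow_le_pow_right hp hj)), Nat.zero_mod]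

theorem div_pow_eq_iff {p n x y : ℕ} (hx : x < p ^ n) (hy : y < p ^ n) (s : ℕ) :
    x / p ^ s = y / p ^ s ↔ ∀ j, s ≤ j → digit p x j = digit p y j := by
  constructor
  · intro h j hj
    obtain ⟨t, rfl⟩ := Nat.exists_eq_add_of_le hj
    rw [← digit_div, ← digit_div, h]
  · intro h
    have hlt : ∀ z, z < p ^ n → z / p ^ s < p ^ n := fun z hz =>
      (Nat.div_le_self _ _).trans_lt hz
    refine eq_of_digit (hlt x hx) (hlt y hy) fun j _ => ?_
    rw [digit_div, digit_div]
    exact h _ (by omega)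

theorem digit_lt {p : ℕ} (hp : 0 < p) (x j : ℕ) : digit p x j < p := Nat.mod_lt _ hp

theorem exists_digit_eq {p : ℕ} (n : ℕ) (f : ℕ → ℕ) (hf : ∀ j < n, f j < p) :
    ∃ x : Fin (p ^ n), ∀ j < n, digit p x j = f j := by
  refine ⟨finFunctionFinEquiv fun j : Fin n => ⟨f j, hf j j.2⟩, fun j hj => ?_⟩
  have := congrFun (finFunctionFinEquiv.symm_apply_apply
    fun j : Fin n => (⟨f j, hf j j.2⟩ : Fin p)) ⟨j, hj⟩
  simpa [finFunctionFinEquiv, digit] using congrArg Fin.val this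

/-! ### Indicator matrices -/

/-- The 0-1 matrix of a binary relation. -/
noncomputable def ind (R : Type*) [Zero R] [One R] {α : Type*} (r : α → α → Prop) :
    Matrix α α R :=
  open Classical in Matrix.of fun x y => if r x y then 1 else 0

open Classical in
theorem ind_apply (R : Type*) [Zero R] [One R] {α : Type*} (r : α → α → Prop) (x y : α) :
    ind R r x y = if r x y then 1 else 0 := rfl

/-- An entry of the product counts intermediate points. Uniqueness `hu` keeps the count at 0 or 1,
so the characteristic of `R` plays no role. -/
theorem ind_mul_ind {R : Type*} [CommRing R] {α : Type*} [Fintype α] {r s t : α → α → Prop}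
    (ht : ∀ x z, t x z ↔ ∃ y, r x y ∧ s y z)
    (hu : ∀ x y y' z, r x y → s y z → r x y' → s y' z → y = y') :
    ind R r * ind R s = ind R t := by
  classical
  ext x z
  rw [Matrix.mul_apply, ind_apply]
  by_cases h : t x z
  · rw [if_pos h]
    obtain ⟨y, h1, h2⟩ := (ht x z).1 h
    rw [Finset.sum_eq_single y]
    · rw [ind_apply, ind_apply, if_pos h1, if_pos h2, mul_one]
    · intro y' _ hne
      rw [ind_apply, ind_apply]
      by_cases h3 : r x y'
      · by_cases h4 : s y' z
        · exact absurd (hu _ _ _ _ h3 h4 h1 h2) hne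
        · simp [h4]
      · simp [h3]
    · simp
  · rw [if_neg h]
    refine Finset.sum_eq_zero fun y _ => ?_
    rw [ind_apply, ind_apply]
    by_cases h3 : r x y
    · by_cases h4 : s y z
      · exact absurd ((ht x z).2 ⟨y, h3, h4⟩) h
      · simp [h4]
    · simp [h3]

theorem relOf_ind (R : Type*) [Zero R] [One R] [NeZero (1 : R)] {α : Type*} (r : α → α → Prop) :
    relOf (ind R r) = {q | r q.1 q.2} := by
  classical
  ext q
  simp [relOf, ind_apply]

/-! ### Brauer's matrices in terms of digits. -/

/-- The relation of the matrix assigned to the generator with number `i`, counted from `0`. -/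
def cupRel (p n i : ℕ) (x y : Fin (p ^ n)) : Prop :=
  digit p x i = digit p x (i + 1) ∧ digit p y i = digit p y (i + 1) ∧
    ∀ j, j ≠ i → j ≠ i + 1 → digit p x j = digit p y j

/-- Lexicographic numbering of a Kronecker product is base `p` expansion: the left factor acts on
the digits from `i + 2` on, the middle one on the digits `i + 1` and `i`, the right one on the
digits below `i`. -/
theorem brauerMatrix_eq_ind (R : Type*) [CommRing R] {p n : ℕ} (i : Fin (n - 1)) :
    brauerMatrix R p n i = ind R (cupRel p n i) := by
  classical
  ext x y
  have hE : ∀ a b : Fin (p * p), ((E R p).transpose * E R p) a b =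
      if ((a : ℕ) / p = a % p ∧ (b : ℕ) / p = b % p) then 1 else 0 := by
    intro a b
    simp only [Matrix.mul_apply, Matrix.transpose_apply, E, Matrix.of_apply,
      finProdFinEquiv_symm_apply, Fin.ext_iff, Fin.coe_divNat, Fin.coe_modNat]
    by_cases ha : (a : ℕ) / p = a % p <;> by_cases hb : (b : ℕ) / p = b % p <;> simp [ha, hb]
  have h1 : ∀ z : ℕ, z / p ^ (i : ℕ) % (p * p) / p = digit p z (i + 1) := by
    intro z
    rw [Nat.mod_mul_right_div_self, Nat.div_div_eq_div_mul, digit, pow_succ]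
  have h2 : ∀ z : ℕ, z / p ^ (i : ℕ) % (p * p) % p = digit p z i := by
    intro z
    rw [Nat.mod_mul_right_mod, digit]
  have h3 : ∀ z : ℕ, z / p ^ (i : ℕ) / (p * p) = z / p ^ ((i : ℕ) + 2) := by
    intro z
    rw [Nat.div_div_eq_div_mul, pow_add, pow_two]
  have key : cupRel p n i x y ↔ ((x : ℕ) / p ^ ((i : ℕ) + 2) = y / p ^ ((i : ℕ) + 2) ∧
      (digit p x (i + 1) = digit p x i ∧ digit p y (i + 1) = digit p y i)) ∧
      (x : ℕ) % p ^ (i : ℕ) = y % p ^ (i : ℕ) := by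
    rw [div_pow_eq_iff x.2 y.2, mod_pow_eq_iff, cupRel]
    constructor
    · rintro ⟨a, b, c⟩
      exact ⟨⟨fun j hj => c j (by omega) (by omega), a.symm, b.symm⟩,
        fun j hj => c j (by omega) (by omega)⟩
    · rintro ⟨⟨a, b, c⟩, d⟩
      refine ⟨b.symm, c.symm, fun j hj hj' => ?_⟩
      rcases lt_or_ge j (i : ℕ) with h | h
      · exact d j h
      · exact a j (by omega)
  simp only [brauerMatrix, kron, Matrix.submatrix_apply, Matrix.kroneckerMap_apply,
    finProdFinEquiv_symm_apply, hE, Matrix.one_apply, Fin.ext_iff, Fin.coe_divNat, Fin.coe_modNat,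
    Fin.val_cast, h1, h2, h3, ind_apply]
  have hm : ∀ (P Q : Prop) [Decidable P] [Decidable Q], (if P then (1 : R) else 0) * (if Q then 1 else 0) =
      if P ∧ Q then 1 else 0 := by
    intro P Q _ _
    by_cases hP : P <;> simp [hP]
  simp only [hm]
  exact if_congr key.symm rfl rfl

/-! ### Noncrossing matchings of linear words -/

/-- Delete the letters number `g` and `g + 1`. -/
def del (g : ℕ) (u : ℕ → ℕ) : ℕ → ℕ := fun j => if j < g then u j else u (j + 2)

/-- The sequence `k 0, …, k (m - 1)` describes a noncrossing matching of `2 m + 2` points on a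
line, built by inserting adjacent pairs; the word `u` is compatible with it if matched letters
are equal. -/
def Compat (k : ℕ → ℕ) : ℕ → (ℕ → ℕ) → Prop
  | 0, u => u 0 = u 1
  | m + 1, u => u (m + 1 + k m) = u (m + 1 + k m + 1) ∧ Compat k m (del (m + 1 + k m) u)

theorem compat_congr_left {k k' : ℕ → ℕ} {m : ℕ} (h : ∀ j < m, k j = k' j) (u : ℕ → ℕ) :
    Compat k m u ↔ Compat k' m u := by
  induction m generalizing u with
  | zero => rfl
  | succ m ih => rw [Compat, Compat, h m (by omega), ih fun j hj => h j (by omega)]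

theorem Compat.congr_right {k : ℕ → ℕ} {m : ℕ} (hk : ∀ j < m, k j ≤ j + 1) {u v : ℕ → ℕ}
    (h : ∀ j < 2 * m + 2, u j = v j) (hu : Compat k m u) : Compat k m v := by
  induction m generalizing u v with
  | zero =>
    rw [Compat] at hu ⊢
    rw [← h 0 (by omega), ← h 1 (by omega), hu]
  | succ m ih =>
    have := hk m (by omega)
    refine ⟨?_, ih (fun j hj => hk j (by omega)) ?_ hu.2⟩
    · rw [← h _ (by omega), ← h _ (by omega), hu.1]
    · intro j hj
      simp only [del]
      split_ifs
      · exact h _ (by omega)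
      · exact h _ (by omega)

/-- The word `x₀ … x_{s-1} y_{s-1} … y₀`, continued by zeros. -/
def lin (s : ℕ) (x y : ℕ → ℕ) : ℕ → ℕ := fun j =>
  if j < s then x j else if j < 2 * s then y (2 * s - 1 - j) else 0

/-- The relation between the labels of the top and the bottom points of the diagram of the
word described by `k 0, …, k (m - 1)`, on `m + 1` strands, extended by vertical strands. -/
def MatchRel (p n : ℕ) (k : ℕ → ℕ) (m : ℕ) (x y : Fin (p ^ n)) : Prop :=
  (∀ j, m < j → digit p x j = digit p y j) ∧ Compat k m (lin (m + 1) (digit p x) (digit p y))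

theorem matchRel_zero {p n : ℕ} {k : ℕ → ℕ} {x y : Fin (p ^ n)} :
    MatchRel p n k 0 x y ↔ x = y := by
  constructor
  · rintro ⟨h, h0⟩
    refine Fin.ext (eq_of_digit x.2 y.2 fun j _ => ?_)
    rcases Nat.eq_zero_or_pos j with rfl | hj
    · simpa [Compat, lin] using h0
    · exact h j hj
  · rintro rfl
    exact ⟨fun _ _ => rfl, by simp [Compat, lin]⟩

/-- An empty block adds a vertical strand, whose two ends are adjacent at the turning point of
`lin`. -/
theorem matchRel_succ_of_eq_zero {p n : ℕ} {k : ℕ → ℕ} {m : ℕ} (hk : k m = 0)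
    {x y : Fin (p ^ n)} : MatchRel p n k (m + 1) x y ↔ MatchRel p n k m x y := by
  have e : del (m + 1) (lin (m + 1 + 1) (digit p x) (digit p y)) =
      lin (m + 1) (digit p x) (digit p y) := by
    funext j
    simp only [del, lin]
    split_ifs <;> first | rfl | omega | (congr 1; omega)
  have e0 : lin (m + 1 + 1) (digit p x) (digit p y) (m + 1) = digit p x (m + 1) := by
    simp [lin]
  have e1 : lin (m + 1 + 1) (digit p x) (digit p y) (m + 1 + 1) = digit p y (m + 1) := by
    simp only [lin]
    split_ifs <;> first | omega | (congr 1; omega)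
  simp only [MatchRel, Compat, hk, Nat.add_zero, e, e0, e1]
  constructor
  · rintro ⟨h, h1, h2⟩
    refine ⟨fun j hj => ?_, h2⟩
    rcases Nat.eq_or_lt_of_le (Nat.succ_le_of_lt hj) with h3 | h3
    · rw [← h3]; exact h1
    · exact h j h3
  · rintro ⟨h, h2⟩
    exact ⟨fun j hj => h j (by omega), h _ (by omega), h2⟩

/-- The sequence `k` with `K` as entry number `m`. -/
def setAt (k : ℕ → ℕ) (m K : ℕ) : ℕ → ℕ := fun j => if j = m then K else k j

@[simp] theorem setAt_self (k : ℕ → ℕ) (m K : ℕ) : setAt k m K m = K := if_pos rfl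

theorem setAt_of_ne (k : ℕ → ℕ) {m j : ℕ} (K : ℕ) (h : j ≠ m) : setAt k m K j = k j := if_neg h

theorem matchRel_setAt {p n : ℕ} {k : ℕ → ℕ} {m K : ℕ} {x y : Fin (p ^ n)} :
    MatchRel p n (setAt k m K) (m + 1) x y ↔ (∀ j, m + 1 < j → digit p x j = digit p y j) ∧
      lin (m + 2) (digit p x) (digit p y) (m + 1 + K) =
        lin (m + 2) (digit p x) (digit p y) (m + 1 + K + 1) ∧
      Compat k m (del (m + 1 + K) (lin (m + 2) (digit p x) (digit p y))) := by
  rw [MatchRel, Compat, setAt_self, compat_congr_left fun j hj => setAt_of_ne k K hj.ne]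

/-- No loop is closed: the common digit of the middle point on the cup is tied by the inserted pair
to a digit of `x` (if `K = 0`) or of `z`. -/
theorem cup_unique {p n : ℕ} {k : ℕ → ℕ} {m K : ℕ} (hK : K ≤ m) {x y y' z : Fin (p ^ n)}
    (hy : MatchRel p n (setAt k m K) (m + 1) x y) (hz : cupRel p n (m - K) y z)
    (hy' : MatchRel p n (setAt k m K) (m + 1) x y') (hz' : cupRel p n (m - K) y' z) : y = y' := by
  rw [matchRel_setAt] at hy hy'
  have key : ∀ w : Fin (p ^ n), lin (m + 2) (digit p x) (digit p w) (m + 1 + K) =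
      lin (m + 2) (digit p x) (digit p w) (m + 1 + K + 1) → cupRel p n (m - K) w z →
      digit p w (m - K + 1) =
        if K = 0 then digit p x (m + 1) else digit p z (m - K + 2) := by
    intro w h1 h2
    have e : lin (m + 2) (digit p x) (digit p w) (m + 1 + K + 1) = digit p w (m - K + 1) := by
      simp only [lin]
      split_ifs <;> first | omega | (congr 1; omega)
    rw [← e, ← h1]
    split_ifs with h0
    · subst h0; simp [lin]
    · rw [← h2.2.2 _ (by omega) (by omega)]
      simp only [lin]
      split_ifs <;> first | omega | (congr 1; omega)
  have a := key y hy.2.1 hz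
  have b := key y' hy'.2.1 hz'
  refine Fin.ext (eq_of_digit y.2 y'.2 fun j _ => ?_)
  by_cases h1 : j = m - K + 1
  · rw [h1, a, b]
  by_cases h2 : j = m - K
  · rw [h2, hz.1, hz'.1, a, b]
  rw [hz.2.2 j h2 h1, hz'.2.2 j h2 h1]

/-- One more letter in the block moves the inserted pair from position `m + 1 + K` to the next
position and leaves the rest of the matching unchanged; `main` compares the words left after
deleting the pair. -/
theorem matchRel_cup {p n : ℕ} {k : ℕ → ℕ} {m K : ℕ} (hk : ∀ j < m, k j ≤ j + 1) (hp : 0 < p)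
    (hn : m + 2 ≤ n) (hK : K ≤ m) (x z : Fin (p ^ n)) :
    MatchRel p n (setAt k m (K + 1)) (m + 1) x z ↔
      ∃ y, MatchRel p n (setAt k m K) (m + 1) x y ∧ cupRel p n (m - K) y z := by
  have main : ∀ y, (∀ j, j ≠ m - K → j ≠ m - K + 1 → digit p y j = digit p z j) →
      digit p y (m - K) = digit p y (m - K + 1) →
      lin (m + 2) (digit p x) (digit p y) (m + 1 + K) = digit p y (m - K + 1) →
      ∀ j < 2 * m + 2, del (m + 1 + K) (lin (m + 2) (digit p x) (digit p y)) j =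
        del (m + 1 + (K + 1)) (lin (m + 2) (digit p x) (digit p z)) j := by
    intro y h1 h2 h3 j hj
    rcases lt_trichotomy j (m + 1 + K) with h | h | h
    · simp only [del, if_pos h, if_pos (show j < m + 1 + (K + 1) by omega), lin]
      split_ifs <;> first | rfl | exact h1 _ (by omega) (by omega)
    -- Here the left side keeps the letter after the deleted pair and the right side the letter
    -- before it; the cup and the pair make them equal.
    · subst h
      have e1 : lin (m + 2) (digit p x) (digit p y) (m + 1 + K + 2) = digit p y (m - K) := by
        simp only [lin]
        split_ifs <;> first | omega | (congr 1; omega)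
      simp only [del, lt_irrefl, if_false, e1, if_pos (show m + 1 + K < m + 1 + (K + 1) by omega)]
      rw [h2, ← h3]
      simp only [lin]
      split_ifs <;> first | rfl | exact h1 _ (by omega) (by omega)
    · simp only [del, if_neg (show ¬ j < m + 1 + K by omega),
        if_neg (show ¬ j < m + 1 + (K + 1) by omega), lin]
      split_ifs <;> first | rfl | exact h1 _ (by omega) (by omega)
  have ez : ∀ w : Fin (p ^ n), lin (m + 2) (digit p x) (digit p w) (m + 1 + (K + 1)) =
      digit p w (m - K + 1) := by
    intro w
    simp only [lin]
    split_ifs <;> first | omega | (congr 1; omega)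
  have ez' : ∀ w : Fin (p ^ n), lin (m + 2) (digit p x) (digit p w) (m + 1 + (K + 1) + 1) =
      digit p w (m - K) := by
    intro w
    simp only [lin]
    split_ifs <;> first | omega | (congr 1; omega)
  simp only [matchRel_setAt]
  constructor
  · rintro ⟨h1, h2, h3⟩
    -- The two digits on the cup are forced: they equal the partner of `m - K + 1` under the pair at
    -- `m + 1 + K`, a label already fixed by `x` and `z`.
    obtain ⟨y, hy⟩ := exists_digit_eq n (fun j => if j = m - K ∨ j = m - K + 1 then
      lin (m + 2) (digit p x) (digit p z) (m + 1 + K) else digit p z j) (p := p) (by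
        intro j _
        simp only [lin]
        split_ifs <;> first | exact digit_lt hp _ _ | exact hp)
    have hy0 : ∀ j, j ≠ m - K → j ≠ m - K + 1 → digit p y j = digit p z j := by
      intro j ha hb
      rcases lt_or_ge j n with hj | hj
      · rw [hy j hj, if_neg (by omega)]
      · rw [digit_eq_zero y.2 hj, digit_eq_zero z.2 hj]
    have hy1 : digit p y (m - K) = lin (m + 2) (digit p x) (digit p z) (m + 1 + K) := by
      rw [hy _ (by omega), if_pos (by omega)]
    have hy2 : digit p y (m - K + 1) = lin (m + 2) (digit p x) (digit p z) (m + 1 + K) := by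
      rw [hy _ (by omega), if_pos (by omega)]
    have hy3 : lin (m + 2) (digit p x) (digit p y) (m + 1 + K) = digit p y (m - K + 1) := by
      rw [hy2]
      simp only [lin]
      split_ifs <;> first | rfl | exact hy0 _ (by omega) (by omega)
    refine ⟨y, ⟨fun j hj => ?_, ?_, ?_⟩, hy1.trans hy2.symm, ?_, hy0⟩
    · rw [h1 j hj, hy0 j (by omega) (by omega)]
    · rw [hy3]; exact (ez y).symm
    · exact h3.congr_right hk fun j hj => (main y hy0 (hy1.trans hy2.symm) hy3 j hj).symm
    · rw [← ez', ← ez, h2]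
  · rintro ⟨y, ⟨h1, h2, h3⟩, h4, h5, h6⟩
    refine ⟨fun j hj => ?_, ?_, ?_⟩
    · rw [h1 j hj, h6 j (by omega) (by omega)]
    · rw [ez, ez', h5]
    · exact h3.congr_right hk (main y h6 h4 (h2.trans (ez y)))

/-! ### Words in the generators -/

/-- The block `h_{i,k}` as a list of numbers. -/
def natBlock (i : ℕ) : ℕ → List ℕ
  | 0 => []
  | k + 1 => natBlock i k ++ [i - k]

/-- The word described by `k 0, …, k (m - 1)` as a list of numbers. -/
def natWord (k : ℕ → ℕ) : ℕ → List ℕ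
  | 0 => []
  | m + 1 => natWord k m ++ natBlock m (k m)

theorem natWord_congr {k k' : ℕ → ℕ} {m : ℕ} (h : ∀ j < m, k j = k' j) :
    natWord k m = natWord k' m := by
  induction m with
  | zero => rfl
  | succ m ih => rw [natWord, natWord, h m (by omega), ih fun j hj => h j (by omega)]

theorem natWord_setAt (k : ℕ → ℕ) (m K : ℕ) :
    natWord (setAt k m K) (m + 1) = natWord k m ++ natBlock m K := by
  rw [natWord, setAt_self, natWord_congr fun j hj => setAt_of_ne k K hj.ne]

theorem map_val_blockWord {m : ℕ} (i : Fin m) (k : ℕ) :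
    (blockWord i k).map Fin.val = natBlock i k := by
  induction k with
  | zero => rfl
  | succ k ih => simp [blockWord, natBlock, ih]

/-- A function on `Fin m`, continued by zeros. -/
def extend {m : ℕ} (k : Fin m → ℕ) (j : ℕ) : ℕ := if h : j < m then k ⟨j, h⟩ else 0

@[simp] theorem extend_val {m : ℕ} (k : Fin m → ℕ) (j : Fin m) : extend k j = k j := by
  simp [extend]

theorem flatten_ofFn_natBlock (k : ℕ → ℕ) (m : ℕ) :
    (List.ofFn fun i : Fin m => natBlock i (k i)).flatten = natWord k m := by
  induction m with
  | zero => rfl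
  | succ m ih =>
    rw [List.ofFn_succ', List.concat_eq_append, List.flatten_append, natWord, ← ih]
    simp

theorem map_val_normalWord {n : ℕ} (k : NormalSeq n) :
    (normalWord k).map Fin.val = natWord (extend k.1) (n - 1) := by
  rw [normalWord, List.map_flatten, List.map_ofFn, ← flatten_ofFn_natBlock]
  congr 2
  funext i
  simp [map_val_blockWord]

theorem mem_natBlock_le {i k a : ℕ} (h : a ∈ natBlock i k) : a ≤ i := by
  induction k with
  | zero => simp [natBlock] at h
  | succ k ih =>
    rw [natBlock, List.mem_append, List.mem_singleton] at h
    rcases h with h | h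
    · exact ih h
    · omega

theorem mem_natWord_lt {k : ℕ → ℕ} {m a : ℕ} (h : a ∈ natWord k m) : a < m := by
  induction m with
  | zero => simp [natWord] at h
  | succ m ih =>
    rw [natWord, List.mem_append] at h
    rcases h with h | h
    · exact (ih h).trans (Nat.lt_succ_self m)
    · exact Nat.lt_succ_of_le (mem_natBlock_le h)

theorem relProd_append_singleton {ι : Type*} (l : List (SetRel ι ι)) (r : SetRel ι ι) :
    relProd (l ++ [r]) = (relProd l).comp r := by
  induction l with
  | nil => simp [relProd]
  | cons s l ih => simp only [List.cons_append, relProd, ih, SetRel.comp_assoc]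

/-- The product of the matrices and the composite of the relations of the letters of `w` are
both given by the relation `r`. -/
def Represents (R : Type*) [CommRing R] (p n : ℕ) (w : List ℕ)
    (r : Fin (p ^ n) → Fin (p ^ n) → Prop) : Prop :=
  (w.map fun i => ind R (cupRel p n i)).prod = ind R r ∧
    relProd (w.map fun i => ({q | cupRel p n i q.1 q.2} : SetRel _ _)) = {q | r q.1 q.2}

theorem represents_block (R : Type*) [CommRing R] {p n : ℕ} {k : ℕ → ℕ} {m : ℕ} (hp : 0 < p)
    (hk : ∀ j < m, k j ≤ j + 1) (hn : m + 2 ≤ n)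
    (h : Represents R p n (natWord k m) (MatchRel p n k m)) {K : ℕ} (hK : K ≤ m + 1) :
    Represents R p n (natWord k m ++ natBlock m K) (MatchRel p n (setAt k m K) (m + 1)) := by
  induction K with
  | zero =>
    have e : MatchRel p n (setAt k m 0) (m + 1) = MatchRel p n k m := by
      funext x y
      rw [eq_iff_iff, matchRel_succ_of_eq_zero (setAt_self k m 0), MatchRel, MatchRel,
        compat_congr_left fun j hj => setAt_of_ne k 0 hj.ne]
    rw [e, natBlock, List.append_nil]
    exact h
  | succ K ih =>
    obtain ⟨h1, h2⟩ := ih (by omega)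
    have hc := matchRel_cup (p := p) (n := n) hk hp hn (show K ≤ m by omega)
    rw [natBlock, ← List.append_assoc]
    constructor
    · rw [List.map_append, List.prod_append, h1, List.map_singleton, List.prod_singleton]
      exact ind_mul_ind hc fun x y y' z => cup_unique (by omega)
    · rw [List.map_append, List.map_singleton, relProd_append_singleton, h2]
      ext ⟨x, z⟩
      simp only [SetRel.mem_comp, Set.mem_ofPred_eq]
      exact (hc x z).symm

theorem represents_natWord (R : Type*) [CommRing R] {p n : ℕ} {k : ℕ → ℕ} {m : ℕ} (hp : 0 < p)
    (hk : ∀ j < m, k j ≤ j + 1) (hn : m + 1 ≤ n) :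
    Represents R p n (natWord k m) (MatchRel p n k m) := by
  induction m with
  | zero =>
    have e : MatchRel p n k 0 = fun x y => x = y := by
      funext x y
      exact propext matchRel_zero
    rw [e]
    constructor
    · classical
      ext x y
      simp [natWord, ind_apply, Matrix.one_apply]
    · rfl
  | succ m ih =>
    have := represents_block R hp (fun j hj => hk j (by omega)) hn
      (ih (fun j hj => hk j (by omega)) (by omega)) (hk m (by omega))
    have e : setAt k m (k m) = k := by
      funext j
      by_cases h : j = m
      · rw [h, setAt_self]
      · exact setAt_of_ne _ _ h
    rwa [e] at this

/-! ### Heights and triangularity -/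

/-- The sign of the letter number `j` of `u`. -/
def sgn (u : ℕ → ℕ) (j : ℕ) : ℤ := (-1) ^ (u j + j)

/-- The sum of the first `t` signs. -/
def height (u : ℕ → ℕ) (t : ℕ) : ℤ := ∑ j ∈ Finset.range t, sgn u j

theorem height_succ (u : ℕ → ℕ) (t : ℕ) : height u (t + 1) = height u t + sgn u t :=
  Finset.sum_range_succ _ _

theorem abs_sgn (u : ℕ → ℕ) (j : ℕ) : |sgn u j| = 1 := by simp [sgn, abs_pow]

theorem sgn_succ_of_eq {u : ℕ → ℕ} {g : ℕ} (h : u g = u (g + 1)) : sgn u (g + 1) = -sgn u g := by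
  rw [sgn, sgn, ← h, ← add_assoc, pow_succ]; ring

theorem sgn_del_of_lt {g j : ℕ} (u : ℕ → ℕ) (h : j < g) : sgn (del g u) j = sgn u j := by
  simp [sgn, del, h]

theorem sgn_del_of_le {g j : ℕ} (u : ℕ → ℕ) (h : g ≤ j) : sgn (del g u) j = sgn u (j + 2) := by
  simp only [sgn, del, if_neg (not_lt.2 h)]
  rw [← add_assoc, pow_add _ _ 2]; simp

theorem height_del_of_le {g t : ℕ} (u : ℕ → ℕ) (h : t ≤ g) :
    height (del g u) t = height u t :=
  Finset.sum_congr rfl fun _ hj => sgn_del_of_lt u ((Finset.mem_range.1 hj).trans_le h)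

/-- The deleted pair has opposite signs, and a shift by two positions preserves signs. -/
theorem height_add_two {g : ℕ} {u : ℕ → ℕ} (hu : u g = u (g + 1)) {t : ℕ} (h : g ≤ t) :
    height u (t + 2) = height (del g u) t := by
  induction t, h using Nat.le_induction with
  | base =>
    rw [height_del_of_le u le_rfl, height_succ, height_succ, sgn_succ_of_eq hu]; ring
  | succ t ht ih =>
    rw [show t + 1 + 2 = t + 2 + 1 by omega, height_succ, ih, height_succ, sgn_del_of_le u ht]

/-- Insert an ascent followed by a descent at the position `g`. -/
def ins (g : ℕ) (u : ℕ → ℕ) : ℕ → ℕ := fun j =>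
  if j < g then u j else if j ≤ g + 1 then g % 2 else u (j - 2)

theorem del_ins (g : ℕ) (u : ℕ → ℕ) : del g (ins g u) = u := by
  funext j
  simp only [del, ins]
  split_ifs <;> first | rfl | omega

theorem ins_self (g : ℕ) (u : ℕ → ℕ) : ins g u g = g % 2 := by simp [ins]

theorem ins_self_succ (g : ℕ) (u : ℕ → ℕ) : ins g u (g + 1) = g % 2 := by simp [ins]

theorem ins_eq (g : ℕ) (u : ℕ → ℕ) : ins g u g = ins g u (g + 1) := by
  rw [ins_self, ins_self_succ]

theorem sgn_ins_self (g : ℕ) (u : ℕ → ℕ) : sgn (ins g u) g = 1 := by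
  rw [sgn, ins_self]
  exact Even.neg_one_pow (by rw [Nat.even_iff]; omega)

/-- The word of the opening and closing points of the matching described by
`k 0, …, k (m - 1)`. -/
def openWord (k : ℕ → ℕ) : ℕ → ℕ → ℕ
  | 0 => fun _ => 0
  | m + 1 => ins (m + 1 + k m) (openWord k m)

theorem openWord_lt (k : ℕ → ℕ) (m j : ℕ) : openWord k m j < 2 := by
  induction m generalizing j with
  | zero => simp [openWord]
  | succ m ih =>
    simp only [openWord, ins]
    split_ifs
    · exact ih _
    · omega
    · exact ih _

theorem openWord_eq_zero {k : ℕ → ℕ} {m j : ℕ} (hk : ∀ j < m, k j ≤ j + 1)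
    (hj : 2 * m + 2 ≤ j) : openWord k m j = 0 := by
  induction m generalizing j with
  | zero => rfl
  | succ m ih =>
    have := hk m (by omega)
    simp only [openWord, ins, if_neg (show ¬ j < m + 1 + k m by omega),
      if_neg (show ¬ j ≤ m + 1 + k m + 1 by omega)]
    exact ih (fun j hj => hk j (by omega)) (by omega)

theorem compat_openWord (k : ℕ → ℕ) (m : ℕ) : Compat k m (openWord k m) := by
  induction m with
  | zero => rfl
  | succ m ih => exact ⟨ins_eq _ _, by rw [openWord, del_ins]; exact ih⟩

/-- Pairs completed before `t` cancel and each open arc contributes `1` or `-1`; in `openWord` every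
open arc contributes `1`. The induction removes the last inserted pair, and only a cut through the
middle of that pair needs an estimate. -/
theorem Compat.abs_height_le {k : ℕ → ℕ} {m : ℕ} (hk : ∀ j < m, k j ≤ j + 1) {u : ℕ → ℕ}
    (hu : Compat k m u) {t : ℕ} (ht : t ≤ 2 * m + 2) :
    |height u t| ≤ height (openWord k m) t := by
  induction m generalizing u t with
  | zero =>
    have h1 := sgn_succ_of_eq (g := 0) (u := u) hu
    have h2 := abs_sgn u 0
    rw [zero_add] at h1
    interval_cases t
    · simp [height]
    · simp only [height, Finset.sum_range_one, h2]
      simp [sgn, openWord]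
    · simp only [height, Finset.sum_range_succ, h1]
      simp [sgn, openWord]
  | succ m ih =>
    have hg : k m ≤ m + 1 := hk m (by omega)
    have hk' : ∀ j < m, k j ≤ j + 1 := fun j hj => hk j (by omega)
    obtain ⟨h1, h2⟩ := hu
    have hd : del (m + 1 + k m) (openWord k (m + 1)) = openWord k m := del_ins _ _
    have low : ∀ s ≤ m + 1 + k m, |height u s| ≤ height (openWord k (m + 1)) s := by
      intro s hs
      have := ih hk' h2 (show s ≤ 2 * m + 2 by omega)
      rwa [height_del_of_le u hs, ← hd, height_del_of_le _ hs] at this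
    rcases le_or_gt t (m + 1 + k m) with h | h
    · exact low t h
    rcases Nat.eq_or_lt_of_le (Nat.succ_le_of_lt h) with h | h
    · rw [← h, Nat.succ_eq_add_one, height_succ, height_succ]
      have e : sgn (openWord k (m + 1)) (m + 1 + k m) = 1 := sgn_ins_self _ _
      rw [e]
      exact (abs_add_le _ _).trans (add_le_add (low _ le_rfl) (abs_sgn _ _).le)
    · obtain ⟨s, rfl⟩ : ∃ s, t = s + 2 := ⟨t - 2, by omega⟩
      have h3 : openWord k (m + 1) (m + 1 + k m) = openWord k (m + 1) (m + 1 + k m + 1) :=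
        ins_eq _ _
      rw [height_add_two h1 (by omega), height_add_two h3 (by omega)]
      have := ih hk' h2 (show s ≤ 2 * m + 2 by omega)
      rwa [← hd] at this

theorem openWord_eq_of_height_eq {k k' : ℕ → ℕ} {m : ℕ} (hk : ∀ j < m, k j ≤ j + 1)
    (hk' : ∀ j < m, k' j ≤ j + 1)
    (h : ∀ t ≤ 2 * m + 2, height (openWord k m) t = height (openWord k' m) t) :
    openWord k m = openWord k' m := by
  funext j
  rcases lt_or_ge j (2 * m + 2) with hj | hj
  · have h1 := h (j + 1) hj
    rw [height_succ, height_succ, h j hj.le, add_right_inj, sgn, sgn, pow_add, pow_add] at h1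
    have h2 := mul_right_cancel₀ (pow_ne_zero j (by norm_num : (-1 : ℤ) ≠ 0)) h1
    have a := openWord_lt k m j
    have b := openWord_lt k' m j
    interval_cases openWord k m j <;> interval_cases openWord k' m j <;> simp_all
  · rw [openWord_eq_zero hk hj, openWord_eq_zero hk' hj]

/-! ### Recovering a normal sequence from its Dyck path. -/

/-- The condition on the sequences that describe Jones normal forms. -/
def IsNormal (k : ℕ → ℕ) (m : ℕ) : Prop :=
  (∀ j < m, k j ≤ j + 1) ∧
    ∀ i j, i < j → j < m → 0 < k i → 0 < k j → i + 1 - k i < j + 1 - k j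

theorem IsNormal.mono {k : ℕ → ℕ} {m m' : ℕ} (h : IsNormal k m) (hm : m' ≤ m) :
    IsNormal k m' :=
  ⟨fun j hj => h.1 j (by omega), fun i j hij hj => h.2 i j hij (by omega)⟩

/-- The word `u` has a peak, an ascent followed by a descent, at the position `q`. -/
def Peak (u : ℕ → ℕ) (q : ℕ) : Prop := u q = q % 2 ∧ u (q + 1) = q % 2

theorem peak_ins (g : ℕ) (u : ℕ → ℕ) : Peak (ins g u) g := ⟨ins_self g u, ins_self_succ g u⟩

theorem Peak.of_ins_lt {g q : ℕ} {u : ℕ → ℕ} (h : Peak (ins g u) q) (hq : q < g) :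
    q + 1 < g ∧ Peak u q := by
  obtain ⟨h1, h2⟩ := h
  have hne : q + 1 ≠ g := by
    rintro rfl
    rw [ins_self] at h2
    omega
  refine ⟨by omega, ?_, ?_⟩
  · simpa [ins, hq] using h1
  · simpa [ins, show q + 1 < g by omega] using h2

theorem Peak.of_ins_gt {g q : ℕ} {u : ℕ → ℕ} (h : Peak (ins g u) q) (hq : g < q) :
    g + 2 ≤ q ∧ Peak u (q - 2) := by
  obtain ⟨h1, h2⟩ := h
  have hne : q ≠ g + 1 := by
    rintro rfl
    rw [ins_self_succ] at h1
    omega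
  refine ⟨by omega, ?_, ?_⟩
  · simp only [ins, if_neg (show ¬ q < g by omega), if_neg (show ¬ q ≤ g + 1 by omega)] at h1
    omega
  · simp only [ins, if_neg (show ¬ q + 1 < g by omega), if_neg (show ¬ q + 1 ≤ g + 1 by omega)]
      at h2
    rw [show q - 2 + 1 = q + 1 - 2 by omega]
    omega

/-- A peak at `q ≥ m + 1` joins the bottom points `2 * m - q` and `2 * m + 1 - q`, while `i + 1 - k
i` is the last letter of the block `i`. So a bottom cup lies no further right than the last letter
of some nonempty block. -/
theorem IsNormal.peak_bound {k : ℕ → ℕ} {m : ℕ} (h : IsNormal k m) {q : ℕ} (hq : m + 1 ≤ q)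
    (hq' : q < 2 * m + 1) (hpk : Peak (openWord k m) q) :
    ∃ i < m, 0 < k i ∧ 2 * m ≤ i + 1 - k i + q := by
  induction m generalizing q with
  | zero => omega
  | succ m ih =>
    have h' := h.mono (Nat.le_succ m)
    have hb := h.1 m (by omega)
    rw [openWord] at hpk
    rcases Nat.eq_zero_or_pos (k m) with h0 | h0
    · obtain ⟨h1, h2⟩ := hpk.of_ins_gt (by omega)
      obtain ⟨i, hi, hki, hle⟩ := ih h' (by omega) (by omega) h2
      exact ⟨i, by omega, hki, by omega⟩
    · rcases lt_or_ge q (m + 1 + k m) with hlt | hge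
      · obtain ⟨h1, h2⟩ := hpk.of_ins_lt hlt
        obtain ⟨i, hi, hki, hle⟩ := ih h' (by omega) (by omega) h2
        -- A peak to the left of the newly inserted pair would need an earlier block whose last
        -- letter is not smaller than the new one.
        have := h.2 i m hi (by omega) hki h0
        omega
      · exact ⟨m, by omega, h0, by omega⟩

theorem IsNormal.le_of_peak {k : ℕ → ℕ} {m : ℕ} (h : IsNormal k (m + 1)) (h0 : 0 < k m) {q : ℕ}
    (hq : m + 1 ≤ q) (hq' : q < 2 * m + 3) (hpk : Peak (openWord k (m + 1)) q) :
    m + 1 + k m ≤ q := by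
  by_contra! hlt
  have hb := h.1 m (by omega)
  obtain ⟨h1, h2⟩ := Peak.of_ins_lt hpk hlt
  obtain ⟨i, hi, hki, hle⟩ := (h.mono (Nat.le_succ m)).peak_bound hq (by omega) h2
  have := h.2 i m hi (by omega) hki h0
  omega

/-- The pair inserted last is the first peak at or after `m + 1` on level `m + 1`, also when the
last block is empty. Thus the path determines `k m`; deleting that peak continues the induction. -/
theorem IsNormal.eq_of_openWord_eq {k k' : ℕ → ℕ} {m : ℕ} (hk : IsNormal k m)
    (hk' : IsNormal k' m) (h : openWord k m = openWord k' m) : ∀ j < m, k j = k' j := by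
  induction m with
  | zero => intro j hj; omega
  | succ m ih =>
    have p1 : Peak (openWord k (m + 1)) (m + 1 + k m) := peak_ins _ _
    have p2 : Peak (openWord k' (m + 1)) (m + 1 + k' m) := peak_ins _ _
    have b1 := hk.1 m (by omega)
    have b2 := hk'.1 m (by omega)
    have e : k m = k' m := by
      refine le_antisymm ?_ ?_
      · rcases Nat.eq_zero_or_pos (k m) with h0 | h0
        · omega
        · have := hk.le_of_peak h0 (by omega) (by omega) (h ▸ p2)
          omega
      · rcases Nat.eq_zero_or_pos (k' m) with h0 | h0
        · omega
        · have := hk'.le_of_peak h0 (by omega) (by omega) (h ▸ p1)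
          omega
    have h' : openWord k m = openWord k' m := by
      have := congrArg (del (m + 1 + k m)) h
      rwa [openWord, del_ins, openWord, e, del_ins] at this
    intro j hj
    rcases Nat.eq_or_lt_of_le (Nat.le_of_lt_succ hj) with rfl | hj
    · exact e
    · exact ih (hk.mono (Nat.le_succ m)) (hk'.mono (Nat.le_succ m)) h' j hj

theorem NormalSeq.isNormal {n : ℕ} (k : NormalSeq n) : IsNormal (extend k.1) (n - 1) := by
  constructor
  · intro j hj
    simpa [extend, hj] using k.2.1 ⟨j, hj⟩
  · intro i j hij hj hi hj'
    have hi0 : i < n - 1 := by omega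
    have b1 := k.2.1 ⟨i, hi0⟩
    have b2 := k.2.1 ⟨j, hj⟩
    have := k.2.2 ⟨i, hi0⟩ ⟨j, hj⟩ hij
    simp only [extend, hi0, hj, dif_pos] at hi hj' ⊢
    have := this hi hj'
    simp only at this b1 b2
    omega

/-! ### Linear independence of the matching matrices. -/

theorem exists_lin_eq {p n : ℕ} (hp : 2 ≤ p) {u : ℕ → ℕ} (hu : ∀ j, u j < 2)
    (hu' : ∀ j, 2 * n ≤ j → u j = 0) :
    ∃ x y : Fin (p ^ n), lin n (digit p x) (digit p y) = u := by
  obtain ⟨x, hx⟩ := exists_digit_eq n u (p := p) fun j _ => (hu j).trans_le hp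
  obtain ⟨y, hy⟩ := exists_digit_eq n (fun j => u (2 * n - 1 - j)) (p := p)
    fun j _ => (hu _).trans_le hp
  refine ⟨x, y, funext fun j => ?_⟩
  simp only [lin]
  split_ifs with h1 h2
  · exact hx j h1
  · rw [hy _ (by omega)]
    congr 1
    omega
  · exact (hu' j (by omega)).symm

theorem matchRel_pred_iff {p n : ℕ} (hn : 0 < n) {k : ℕ → ℕ} {x y : Fin (p ^ n)} :
    MatchRel p n k (n - 1) x y ↔ Compat k (n - 1) (lin n (digit p x) (digit p y)) := by
  rw [MatchRel, Nat.sub_add_cancel hn, and_iff_right]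
  intro j hj
  rw [digit_eq_zero x.2 (by omega), digit_eq_zero y.2 (by omega)]

theorem linearIndependent_matchRel (R : Type*) [CommRing R] {n p : ℕ} (hn : 0 < n) (hp : 2 ≤ p) :
    LinearIndependent R
      (fun k : NormalSeq n => ind R (MatchRel p n (extend k.1) (n - 1))) := by
  classical
  rw [linearIndependent_iff']
  intro s c hs i hi
  by_contra hci
  let f : NormalSeq n → Set.Iic (2 * n) → ℤ := fun k t => height (openWord (extend k.1) (n - 1)) t
  -- Among the terms with nonzero coefficient take one with maximal Dyck path. At the entry given by
  -- its open word, any other such term that is nonzero has a path above it, hence the same path,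
  -- hence the same sequence.
  obtain ⟨k, hk⟩ := (s.filter fun k => c k ≠ 0).exists_maximalFor f
    ⟨i, Finset.mem_filter.2 ⟨hi, hci⟩⟩
  obtain ⟨hks, hck⟩ := Finset.mem_filter.1 hk.1
  obtain ⟨x, y, hxy⟩ := exists_lin_eq (p := p) (n := n) hp (openWord_lt (extend k.1) (n - 1))
    fun j hj => openWord_eq_zero k.isNormal.1 (by omega)
  have h := congrFun (congrFun hs x) y
  rw [Matrix.sum_apply, Finset.sum_eq_single k] at h
  · rw [Matrix.smul_apply, ind_apply, if_pos, smul_eq_mul, mul_one] at h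
    · exact hck h
    · rw [matchRel_pred_iff hn, hxy]
      exact compat_openWord _ _
  · intro k' hk's hne
    by_cases hc : c k' = 0
    · simp [hc]
    rw [Matrix.smul_apply, ind_apply, if_neg, smul_zero]
    rw [matchRel_pred_iff hn, hxy]
    intro hcomp
    have hle : ∀ t ≤ 2 * (n - 1) + 2, height (openWord (extend k.1) (n - 1)) t ≤
        height (openWord (extend k'.1) (n - 1)) t := fun t ht =>
      (le_abs_self _).trans (hcomp.abs_height_le k'.isNormal.1 ht)
    have hge := hk.2 (Finset.mem_filter.2 ⟨hk's, hc⟩) fun t => hle t (by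
      have : (t : ℕ) ≤ 2 * n := t.2
      omega)
    refine hne (Subtype.ext (funext fun j => ?_))
    have := k'.isNormal.eq_of_openWord_eq k.isNormal
      (openWord_eq_of_height_eq k'.isNormal.1 k.isNormal.1 fun t ht =>
        le_antisymm (hge ⟨t, show t ≤ 2 * n by omega⟩) (hle t ht)) j j.2
    simpa using this
  · intro h'
    exact absurd hks h'

/-! ### Jones normal forms span -/

/-- The elements `e 0, …, e (N - 1)` satisfy the Temperley–Lieb relations. -/
structure IsTL {K A : Type*} [Field K] [Ring A] [Algebra K A] (δ : K) (e : ℕ → A) (N : ℕ) :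
    Prop where
  comm : ∀ i j, j + 2 ≤ i → i < N → e i * e j = e j * e i
  braid : ∀ i j, j = i + 1 ∨ i = j + 1 → i < N → j < N → e i * e j * e i = e i
  sq : ∀ i, i < N → e i * e i = δ • e i

/-- The product of the elements named by the letters of a word. -/
def wordProd {A : Type*} [Ring A] (e : ℕ → A) (w : List ℕ) : A := (w.map e).prod

section

variable {K A : Type*} [Field K] [Ring A] [Algebra K A] {δ : K} {e : ℕ → A} {N : ℕ}

theorem wordProd_append (e : ℕ → A) (v w : List ℕ) :
    wordProd e (v ++ w) = wordProd e v * wordProd e w := by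
  simp [wordProd]

theorem wordProd_singleton (e : ℕ → A) (i : ℕ) : wordProd e [i] = e i := by
  simp [wordProd]

theorem IsTL.commute_wordProd (h : IsTL δ e N) {i : ℕ} (hi : i < N) {w : List ℕ}
    (hw : ∀ b ∈ w, b < N ∧ (b + 2 ≤ i ∨ i + 2 ≤ b)) :
    e i * wordProd e w = wordProd e w * e i := by
  induction w with
  | nil => simp [wordProd]
  | cons b w ih =>
    have hb : e i * e b = e b * e i := by
      obtain ⟨h1, h2 | h2⟩ := hw b (by simp)
      · exact h.comm i b h2 hi
      · exact (h.comm b i h2 h1).symm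
    have := ih fun c hc => hw c (by simp [hc])
    simp only [wordProd, List.map_cons, List.prod_cons] at this ⊢
    rw [← mul_assoc, hb, mul_assoc, this, mul_assoc]

end

theorem natBlock_add (m s t : ℕ) : natBlock m (s + t) = natBlock m s ++ natBlock (m - s) t := by
  induction t with
  | zero => simp [natBlock]
  | succ t ih =>
    rw [← add_assoc, natBlock, natBlock, ih, List.append_assoc, Nat.sub_sub]

theorem length_natBlock (m k : ℕ) : (natBlock m k).length = k := by
  induction k with
  | zero => rfl
  | succ k ih => simp [natBlock, ih]

theorem le_of_mem_natBlock {m k b : ℕ} (h : b ∈ natBlock m k) : m + 1 ≤ b + k := by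
  induction k with
  | zero => simp [natBlock] at h
  | succ k ih =>
    rw [natBlock, List.mem_append, List.mem_singleton] at h
    rcases h with h | h
    · have := ih h
      omega
    · omega

theorem natWord_eq_of_eq_zero {k : ℕ → ℕ} {m j : ℕ} (hj : j ≤ m)
    (h : ∀ i, j ≤ i → i < m → k i = 0) : natWord k m = natWord k j := by
  induction m, hj using Nat.le_induction with
  | base => rfl
  | succ m hm ih =>
    rw [natWord, h m hm (by omega), natBlock, List.append_nil, ih fun i h1 h2 => h i h1 (by omega)]

theorem IsNormal.setAt {k : ℕ → ℕ} {m K : ℕ} (h : IsNormal k m) (hK : K ≤ m + 1)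
    (h' : 0 < K → ∀ j < m, 0 < k j → j + 1 - k j < m + 1 - K) :
    IsNormal (setAt k m K) (m + 1) := by
  constructor
  · intro j hj
    by_cases hm : j = m
    · rw [hm, setAt_self]; exact hK
    · rw [setAt_of_ne _ _ hm]; exact h.1 j (by omega)
  · intro i j hij hj hi hj'
    rw [setAt_of_ne _ _ (by omega)] at hi ⊢
    by_cases hm : j = m
    · subst hm
      rw [setAt_self] at hj' ⊢
      exact h' hj' i hij hi
    · rw [setAt_of_ne _ _ hm] at hj' ⊢
      exact h.2 i j hij (by omega) hi hj'

/-- A normal word times a generator is proportional to a word that is not longer, or is a normal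
word. -/
theorem IsTL.wordProd_natWord_mul {K A : Type*} [Field K] [Ring A] [Algebra K A] {δ : K}
    {e : ℕ → A} {N : ℕ} (h : IsTL δ e N) {k : ℕ → ℕ} {m : ℕ} (hk : IsNormal k m) (hm : m ≤ N)
    {i : ℕ} (hi : i < m) :
    (∃ (c : K) (w : List ℕ), (∀ b ∈ w, b < m) ∧ w.length ≤ (natWord k m).length ∧
      wordProd e (natWord k m) * e i = c • wordProd e w) ∨
    ∃ k', IsNormal k' m ∧ (natWord k' m).length = (natWord k m).length + 1 ∧
      wordProd e (natWord k m) * e i = wordProd e (natWord k' m) ∧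
      ∀ B, i ≤ B → (∀ j < m, 0 < k j → j + 1 - k j ≤ B) →
        ∀ j < m, 0 < k' j → j + 1 - k' j ≤ B := by
  induction m with
  | zero => omega
  | succ m ih =>
    have hk0 := hk.mono (Nat.le_succ m)
    have hb := hk.1 m (by omega)
    obtain ⟨K', hK⟩ : ∃ K', K' = k m := ⟨_, rfl⟩
    have bound : ∀ (k' : ℕ → ℕ) (K'' B : ℕ), (∀ j < m, 0 < k' j → j + 1 - k' j ≤ B) →
        (0 < K'' → m + 1 - K'' ≤ B) →
        ∀ j < m + 1, 0 < TemperleyLieb.setAt k' m K'' j →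
          j + 1 - TemperleyLieb.setAt k' m K'' j ≤ B := by
      intro k' K'' B h1 h2 j hj h3
      by_cases hjm : j = m
      · subst hjm
        rw [setAt_self] at h3 ⊢
        exact h2 h3
      · rw [setAt_of_ne _ _ hjm] at h3 ⊢
        exact h1 j (by omega) h3
    rw [natWord, ← hK]
    rw [← hK] at hb
    -- the generator commutes with the last block
    by_cases c1 : i < m ∧ i + 2 ≤ m + 1 - K' ∨ i < m ∧ K' = 0
    · have him : i < m := by omega
      have hcomm : wordProd e (natBlock m K') * e i = e i * wordProd e (natBlock m K') := by
        refine (h.commute_wordProd (by omega) fun b hb' => ?_).symm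
        have h1 := le_of_mem_natBlock hb'
        have h2 := mem_natBlock_le hb'
        rcases c1 with c1 | c1
        · exact ⟨by omega, Or.inr (by omega)⟩
        · omega
      have hprod : wordProd e (natWord k m ++ natBlock m K') * e i =
          wordProd e (natWord k m) * e i * wordProd e (natBlock m K') := by
        rw [wordProd_append, mul_assoc, hcomm, mul_assoc]
      rcases ih hk0 (by omega) him with ⟨c, w, h1, h2, h3⟩ | ⟨k', h1, h2, h3, h4⟩
      · left
        refine ⟨c, w ++ natBlock m K', ?_, ?_, ?_⟩
        · intro b hb'
          rcases List.mem_append.1 hb' with hb' | hb'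
          · have := h1 b hb'
            omega
          · have := mem_natBlock_le hb'
            omega
        · simp only [List.length_append]
          omega
        · rw [hprod, h3, wordProd_append, smul_mul_assoc]
      · right
        refine ⟨TemperleyLieb.setAt k' m K', h1.setAt hb ?_, ?_, ?_, ?_⟩
        · intro hpos j hj hkj
          -- This is the purpose of the clause on `B`: `m - K'` bounds `i` and the earlier last
          -- letters, so the changed prefix still ends its blocks below the last letter `m + 1 -
          -- K'`.
          have := h4 (m - K') (by omega) (fun j hj hkj => by
            have := hk.2 j m hj (by omega) hkj (by omega)
            omega) j hj hkj
          omega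
        · rw [natWord_setAt, List.length_append, List.length_append, h2]
          omega
        · rw [natWord_setAt, hprod, h3, wordProd_append]
        · intro B hB hB'
          exact bound _ _ _ (h4 B hB fun j hj => hB' j (by omega)) fun hpos => by
            have := hB' m (by omega) (by omega)
            omega
    -- the last block becomes longer
    by_cases c2 : i = m - K' ∧ K' ≤ m
    · obtain ⟨rfl, hKm⟩ := c2
      have hword : wordProd e (natWord k m ++ natBlock m K') * e (m - K') =
          wordProd e (natWord k m ++ natBlock m (K' + 1)) := by
        rw [natBlock, ← List.append_assoc, wordProd_append e _ [_], wordProd_singleton]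
      by_cases c3 : ∀ j < m, 0 < k j → j + 1 - k j < m - K'
      · right
        refine ⟨TemperleyLieb.setAt k m (K' + 1), hk0.setAt (by omega) ?_, ?_, ?_, ?_⟩
        · intro _ j hj hkj
          have := c3 j hj hkj
          omega
        · simp only [natWord_setAt, List.length_append, length_natBlock]
          omega
        · rw [hword, natWord_setAt]
        · intro B hB hB'
          exact bound _ _ _ (fun j hj => hB' j (by omega)) fun _ => by omega
      -- Some earlier block ends in `m - K'` as well. All blocks between it and the last one are
      -- empty, so this letter moves right up to `m - K' + 1` and the braid relation shortens the
      -- word.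
      · left
        push Not at c3
        obtain ⟨j, hj, hkj, hge⟩ := c3
        have hbj := hk.1 j (by omega)
        have hpos : 0 < K' := by omega
        have hlt := hk.2 j m hj (by omega) hkj (by omega)
        have hz : natWord k m = natWord k (j + 1) := by
          refine natWord_eq_of_eq_zero hj fun i' h1 h2 => ?_
          by_contra hne
          have := hk.2 j i' h1 (by omega) hkj (by omega)
          have := hk.2 i' m h2 (by omega) (by omega) (by omega)
          omega
        obtain ⟨t, ht⟩ : ∃ t, k j = t + 1 := ⟨k j - 1, by omega⟩
        obtain ⟨s, hs⟩ : ∃ s, K' = s + 1 := ⟨K' - 1, by omega⟩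
        have e1 : j - t = m - K' := by omega
        have e2 : m - s = m - K' + 1 := by omega
        have hcomm := h.commute_wordProd (i := m - K') (w := natBlock m s) (by omega)
          fun b hb' => by
            have h1 := le_of_mem_natBlock hb'
            have h2 := mem_natBlock_le hb'
            exact ⟨by omega, Or.inr (by omega)⟩
        refine ⟨1, natWord k j ++ natBlock j t ++ natBlock m s ++ [m - K'], ?_, ?_, ?_⟩
        · intro b hb'
          simp only [List.mem_append, List.mem_singleton] at hb'
          rcases hb' with ((hb' | hb') | hb') | hb'
          · have := mem_natWord_lt hb'
            omega
          · have := mem_natBlock_le hb'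
            omega
          · have := mem_natBlock_le hb'
            omega
          · omega
        · simp only [hz, natWord, List.length_append, length_natBlock, List.length_singleton]
          omega
        · rw [one_smul, hword, hz, natWord, ht, hs, natBlock, natBlock, natBlock, e1, ← hs, e2]
          simp only [wordProd_append, wordProd_singleton, mul_assoc]
          rw [← mul_assoc (e (m - K')) (wordProd e (natBlock m s)), hcomm, mul_assoc,
            ← mul_assoc (e (m - K')) (e (m - K' + 1)),
            h.braid _ _ (Or.inl rfl) (by omega) (by omega)]
    left
    -- the generator is the last letter
    by_cases c3 : i + K' = m + 1
    · obtain ⟨s, hs⟩ : ∃ s, K' = s + 1 := ⟨K' - 1, by omega⟩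
      have e1 : m - s = i := by omega
      refine ⟨δ, natWord k m ++ natBlock m K', ?_, le_rfl, ?_⟩
      · intro b hb'
        rw [hK] at hb'
        exact mem_natWord_lt (m := m + 1) hb'
      · rw [hs, natBlock, e1]
        simp only [wordProd_append, wordProd_singleton, mul_assoc]
        rw [h.sq i (by omega)]
        simp only [mul_smul_comm]
    -- the generator is another letter of the last block
    obtain ⟨r, hr⟩ : ∃ r, K' = m - i + 2 + r := ⟨K' - (m - i + 2), by omega⟩
    -- The appended `i` commutes with the tail, whose letters are at most `i - 2`, and meets `i, i -
    -- 1` in a braid relation.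
    have hsplit : natBlock m K' = natBlock m (m - i) ++ [i] ++ [i - 1] ++ natBlock (i - 2) r := by
      rw [hr, natBlock_add, natBlock_add, show m - (m - i + 2) = i - 2 by omega,
        show m - (m - i) = i by omega]
      simp [natBlock]
    have hcomm := h.commute_wordProd (i := i) (w := natBlock (i - 2) r) (by omega)
      fun b hb' => by
        have h1 := le_of_mem_natBlock hb'
        have h2 := mem_natBlock_le hb'
        exact ⟨by omega, Or.inl (by omega)⟩
    refine ⟨1, natWord k m ++ natBlock m (m - i) ++ [i] ++ natBlock (i - 2) r, ?_, ?_, ?_⟩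
    · intro b hb'
      simp only [List.mem_append, List.mem_singleton] at hb'
      rcases hb' with ((hb' | hb') | hb') | hb'
      · have := mem_natWord_lt hb'
        omega
      · have := mem_natBlock_le hb'
        omega
      · omega
      · have := mem_natBlock_le hb'
        omega
    · simp only [List.length_append, length_natBlock, List.length_singleton]
      omega
    · rw [one_smul, hsplit]
      simp only [wordProd_append, wordProd_singleton, mul_assoc]
      rw [← hcomm, ← mul_assoc (e (i - 1)), ← mul_assoc (e i), ← mul_assoc (e i),
        h.braid _ _ (Or.inr (by omega)) (by omega) (by omega)]

section

variable {K A : Type*} [Field K] [Ring A] [Algebra K A] {δ : K} {e : ℕ → A} {N : ℕ}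

/-- The length bound lets the induction hypothesis apply again to the words, no longer than the
normal word, that appear after multiplying by the last letter. -/
theorem IsTL.wordProd_mem_span_of_length (h : IsTL δ e N) (L : ℕ) {w : List ℕ}
    (hw : ∀ b ∈ w, b < N) (hL : w.length ≤ L) :
    wordProd e w ∈ Submodule.span K {a | ∃ k, IsNormal k N ∧ (natWord k N).length ≤ L ∧
      wordProd e (natWord k N) = a} := by
  induction L generalizing w with
  | zero =>
    obtain rfl : w = [] := List.length_eq_zero_iff.1 (by omega)
    have e0 : natWord (fun _ => 0) N = [] := natWord_eq_of_eq_zero (Nat.zero_le N) fun _ _ _ => rfl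
    refine Submodule.subset_span ⟨fun _ => 0, ⟨fun j _ => Nat.zero_le _, fun i j _ _ hi => ?_⟩, ?_, ?_⟩
    · exact absurd hi (lt_irrefl 0)
    · simp [e0]
    · rw [e0]
  | succ L ih =>
    have mono : Submodule.span K {a | ∃ k, IsNormal k N ∧ (natWord k N).length ≤ L ∧
        wordProd e (natWord k N) = a} ≤ Submodule.span K {a | ∃ k, IsNormal k N ∧
          (natWord k N).length ≤ L + 1 ∧ wordProd e (natWord k N) = a} :=
      Submodule.span_mono fun a ⟨k, h1, h2, h3⟩ => ⟨k, h1, by omega, h3⟩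
    rcases List.eq_nil_or_concat w with rfl | ⟨w', i, rfl⟩
    · exact mono (ih hw (Nat.zero_le _))
    rw [List.concat_eq_append] at hw hL ⊢
    have hi : i < N := hw i (by simp)
    rw [wordProd_append, wordProd_singleton]
    have h' := ih (w := w') (fun b hb => hw b (by simp [hb])) (by simpa using hL)
    refine Submodule.span_induction (p := fun a _ => a * e i ∈ _) ?_ ?_ ?_ ?_ h'
    · rintro _ ⟨k, h1, h2, rfl⟩
      rcases h.wordProd_natWord_mul h1 le_rfl hi with ⟨c, v, h3, h4, h5⟩ | ⟨k', h3, h4, h5, -⟩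
      · rw [h5]
        exact Submodule.smul_mem _ _ (mono (ih h3 (by omega)))
      · exact Submodule.subset_span ⟨k', h3, by omega, h5.symm⟩
    · rw [zero_mul]; exact zero_mem _
    · intro a b _ _ ha hb
      rw [add_mul]
      exact add_mem ha hb
    · intro c a _ ha
      rw [smul_mul_assoc]
      exact Submodule.smul_mem _ c ha

/-- The normal sequence with given entries. -/
def IsNormal.toSeq {k : ℕ → ℕ} {n : ℕ} (h : IsNormal k (n - 1)) : NormalSeq n :=
  ⟨fun j => k j, fun j => h.1 j j.2, fun i j hij hi hj => by
    have h1 := h.2 i j hij j.2 hi hj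
    have h2 := h.1 i i.2
    have h3 := h.1 j j.2
    simp only
    omega⟩

theorem IsTL.wordProd_mem_span {n : ℕ} (h : IsTL δ e (n - 1)) {w : List ℕ}
    (hw : ∀ b ∈ w, b < n - 1) :
    wordProd e w ∈ Submodule.span K (Set.range fun k : NormalSeq n =>
      wordProd e (natWord (extend k.1) (n - 1))) := by
  refine Submodule.span_mono ?_ (h.wordProd_mem_span_of_length w.length hw le_rfl)
  rintro _ ⟨k, hk, -, rfl⟩
  refine ⟨hk.toSeq, ?_⟩
  have : natWord (extend hk.toSeq.1) (n - 1) = natWord k (n - 1) :=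
    natWord_congr fun j hj => by simp [extend, hj, IsNormal.toSeq]
  simp only [this]

end

/-! ### Spanning in the Temperley–Lieb algebra itself. -/

/-- The generators of the Temperley–Lieb algebra, numbered by natural numbers. -/
def natGen (K : Type*) [Field K] (n : ℕ) (δ : K) (j : ℕ) : Alg K n δ :=
  if h : j < n - 1 then gen K n δ ⟨j, h⟩ else 1

section

variable {K : Type*} [Field K] {n : ℕ} {δ : K}

theorem natGen_val (i : Fin (n - 1)) : natGen K n δ i = gen K n δ i := by
  simp [natGen]

theorem gen_comm {i j : Fin (n - 1)} (hij : (j : ℕ) + 2 ≤ i) :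
    gen K n δ i * gen K n δ j = gen K n δ j * gen K n δ i := by
  simpa [gen] using RingQuot.mkAlgHom_rel K (Rel.comm (δ := δ) i j hij)

theorem gen_braid {i j : Fin (n - 1)} (hij : (j : ℕ) = (i : ℕ) + 1 ∨ (i : ℕ) = (j : ℕ) + 1) :
    gen K n δ i * gen K n δ j * gen K n δ i = gen K n δ i := by
  simpa [gen] using RingQuot.mkAlgHom_rel K (Rel.braid (δ := δ) i j hij)

theorem gen_sq (i : Fin (n - 1)) : gen K n δ i * gen K n δ i = δ • gen K n δ i := by
  simpa [gen] using RingQuot.mkAlgHom_rel K (Rel.sq (δ := δ) i)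

theorem isTL_natGen : IsTL δ (natGen K n δ) (n - 1) where
  comm i j hij hi := by
    have hj : j < n - 1 := by omega
    simp only [natGen, hi, hj, dif_pos]
    exact gen_comm hij
  braid i j hij hi hj := by
    simp only [natGen, hi, hj, dif_pos]
    exact gen_braid hij
  sq i hi := by
    simp only [natGen, hi, dif_pos]
    exact gen_sq _

theorem normalForm_eq_wordProd (k : NormalSeq n) :
    normalForm K δ k = wordProd (natGen K n δ) (natWord (extend k.1) (n - 1)) := by
  rw [normalForm, wordProd, ← map_val_normalWord, List.map_map]
  congr 2
  funext i
  exact (natGen_val i).symm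

theorem span_normalForm :
    Submodule.span K (Set.range fun k : NormalSeq n => normalForm K δ k) = ⊤ := by
  simp only [normalForm_eq_wordProd]
  set V := Submodule.span K (Set.range fun k : NormalSeq n =>
    wordProd (natGen K n δ) (natWord (extend k.1) (n - 1))) with hV
  have hgen : ∀ v ∈ V, ∀ i, v * gen K n δ i ∈ V := by
    intro v hv i
    refine Submodule.span_induction (p := fun a _ => a * gen K n δ i ∈ V) ?_ ?_ ?_ ?_ hv
    · rintro _ ⟨k, rfl⟩
      have := isTL_natGen.wordProd_mem_span (K := K) (δ := δ)
        (w := natWord (extend k.1) (n - 1) ++ [(i : ℕ)]) (by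
          intro b hb
          rcases List.mem_append.1 hb with hb | hb
          · exact mem_natWord_lt hb
          · rw [List.mem_singleton.1 hb]; exact i.2)
      rwa [wordProd_append, wordProd_singleton, natGen_val] at this
    · rw [zero_mul]; exact zero_mem _
    · intro a b _ _ ha hb
      rw [add_mul]
      exact add_mem ha hb
    · intro c a _ ha
      rw [smul_mul_assoc]
      exact Submodule.smul_mem _ c ha
  -- The span is a right ideal; as it contains `1`, it is everything.
  have hall : ∀ x : FreeAlgebra K (Fin (n - 1)), ∀ v ∈ V,
      v * RingQuot.mkAlgHom K (Rel K n δ) x ∈ V := by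
    intro x
    induction x using FreeAlgebra.induction with
    | grade0 r =>
      intro v hv
      rw [AlgHom.commutes, ← Algebra.commutes, ← Algebra.smul_def]
      exact Submodule.smul_mem _ r hv
    | grade1 i => exact fun v hv => hgen v hv i
    | mul a b ha hb =>
      intro v hv
      rw [map_mul, ← mul_assoc]
      exact hb _ (ha v hv)
    | add a b ha hb =>
      intro v hv
      rw [map_add, mul_add]
      exact add_mem (ha v hv) (hb v hv)
  refine Submodule.eq_top_iff'.2 fun a => ?_
  obtain ⟨x, rfl⟩ := RingQuot.mkAlgHom_surjective K (Rel K n δ) a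
  have h1 : (1 : Alg K n δ) ∈ V := by
    have := isTL_natGen.wordProd_mem_span (K := K) (n := n) (δ := δ) (w := []) (by simp)
    rwa [wordProd, List.map_nil, List.prod_nil] at this
  simpa using hall x 1 h1

end

/-! ### Brauer's representation -/

/-- The words `x` and `y` are each constant on the positions `a` and `b` and agree elsewhere. -/
def pairRel (p n a b : ℕ) (x y : Fin (p ^ n)) : Prop :=
  digit p x a = digit p x b ∧ digit p y a = digit p y b ∧
    ∀ j, j ≠ a → j ≠ b → digit p x j = digit p y j

theorem cupRel_eq_pairRel (p n i : ℕ) : cupRel p n i = pairRel p n i (i + 1) := rfl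

theorem pairRel_swap (p n a b : ℕ) : pairRel p n a b = pairRel p n b a := by
  funext x y
  rw [eq_iff_iff, pairRel, pairRel, eq_comm, @eq_comm _ (digit p y a)]
  exact and_congr_right fun _ => and_congr_right fun _ =>
    forall_congr' fun _ => ⟨fun h h1 h2 => h h2 h1, fun h h1 h2 => h h2 h1⟩

theorem exists_digit_eq_of_ite {p n : ℕ} (x : Fin (p ^ n)) {a b v w : ℕ} (ha : a < n) (hb : b < n)
    (hab : a ≠ b) (hv : v < p) (hw : w < p) :
    ∃ y : Fin (p ^ n), digit p y a = v ∧ digit p y b = w ∧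
      ∀ j, j ≠ a → j ≠ b → digit p y j = digit p x j := by
  obtain ⟨y, hy⟩ := exists_digit_eq n
    (fun j => if j = a then v else if j = b then w else digit p x j) (p := p) (by
      intro j _
      split_ifs
      · exact hv
      · exact hw
      · exact digit_lt (by omega) _ _)
  refine ⟨y, ?_, ?_, ?_⟩
  · rw [hy a ha, if_pos rfl]
  · rw [hy b hb, if_neg hab.symm, if_pos rfl]
  · intro j h1 h2
    rcases lt_or_ge j n with hj | hj
    · rw [hy j hj, if_neg h1, if_neg h2]
    · rw [digit_eq_zero y.2 hj, digit_eq_zero x.2 hj]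

theorem eq_of_forall_digit {p n : ℕ} {x y : Fin (p ^ n)} (h : ∀ j, digit p x j = digit p y j) :
    x = y :=
  Fin.ext (eq_of_digit x.2 y.2 fun j _ => h j)

section

variable {R : Type*} [CommRing R] {p n a b c d : ℕ}

/-- The closed loop: the intermediate points are `x` with a common value written at `a` and `b`, and
there are `p` such values. -/
theorem pairRel_sq (hp : 0 < p) (ha : a < n) (hb : b < n) (hab : a ≠ b) :
    ind R (pairRel p n a b) * ind R (pairRel p n a b) = (p : R) • ind R (pairRel p n a b) := by
  classical
  ext x z
  rw [Matrix.mul_apply, Matrix.smul_apply, ind_apply, smul_eq_mul]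
  by_cases h : pairRel p n a b x z
  · rw [if_pos h, mul_one]
    choose f hf using fun v : Fin p => exists_digit_eq_of_ite x ha hb hab v.2 v.2
    have hinj : Function.Injective f := fun v w hvw => by
      have := (hf v).1
      rw [hvw, (hf w).1] at this
      exact Fin.ext this.symm
    rw [← Finset.sum_subset (Finset.subset_univ (Finset.univ.image f)),
      Finset.sum_image fun v _ w _ hvw => hinj hvw]
    · rw [Finset.sum_congr rfl (g := fun _ => (1 : R))]
      · simp
      · intro v _
        obtain ⟨h1, h2, h3⟩ := hf v
        rw [ind_apply, ind_apply, if_pos, if_pos, mul_one]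
        · exact ⟨h1.trans h2.symm, h.2.1, fun j hj hj' => (h3 j hj hj').trans (h.2.2 j hj hj')⟩
        · exact ⟨h.1, h1.trans h2.symm, fun j hj hj' => (h3 j hj hj').symm⟩
    · intro y _ hy
      rw [ind_apply, if_neg, zero_mul]
      intro hxy
      refine hy (Finset.mem_image.2 ⟨⟨digit p y a, digit_lt hp _ _⟩, Finset.mem_univ _, ?_⟩)
      obtain ⟨h1, h2, h3⟩ := hf ⟨digit p y a, digit_lt hp _ _⟩
      refine eq_of_forall_digit fun j => ?_
      by_cases hja : j = a
      · rw [hja, h1]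
      by_cases hjb : j = b
      · exact hjb ▸ h2.trans hxy.2.1
      · rw [h3 j hja hjb, hxy.2.2 j hja hjb]
  · rw [if_neg h, mul_zero]
    refine Finset.sum_eq_zero fun y _ => ?_
    rw [ind_apply, ind_apply]
    by_cases h1 : pairRel p n a b x y
    · by_cases h2 : pairRel p n a b y z
      · exact absurd ⟨h1.1, h2.2.1, fun j hj hj' => (h1.2.2 j hj hj').trans (h2.2.2 j hj hj')⟩ h
      · simp [h2]
    · simp [h1]

/-- The resulting relation is symmetric in the two pairs, which yields commutation. -/
theorem pairRel_mul_of_disjoint (hp : 0 < p) (ha : a < n) (hb : b < n) (hab : a ≠ b)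
    (hac : a ≠ c) (had : a ≠ d) (hbc : b ≠ c) (hbd : b ≠ d) :
    ind R (pairRel p n a b) * ind R (pairRel p n c d) = ind R fun x z : Fin (p ^ n) =>
      (digit p x a = digit p x b ∧ digit p z a = digit p z b) ∧
      (digit p x c = digit p x d ∧ digit p z c = digit p z d) ∧
      ∀ j, (j ≠ a ∧ j ≠ b) → (j ≠ c ∧ j ≠ d) → digit p x j = digit p z j := by
  refine ind_mul_ind ?_ ?_
  · intro x z
    constructor
    · rintro ⟨⟨h1, h2⟩, ⟨h3, h4⟩, h5⟩
      obtain ⟨y, hy1, hy2, hy3⟩ := exists_digit_eq_of_ite x ha hb hab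
        (digit_lt hp z a) (digit_lt hp z b)
      refine ⟨y, ⟨h1, by rw [hy1, hy2, h2], fun j hj hj' => (hy3 j hj hj').symm⟩, ?_, h4, ?_⟩
      · rw [hy3 c hac.symm hbc.symm, hy3 d had.symm hbd.symm, h3]
      · intro j hj hj'
        by_cases hja : j = a
        · rw [hja, hy1]
        by_cases hjb : j = b
        · rw [hjb, hy2]
        rw [hy3 j hja hjb, h5 j ⟨hja, hjb⟩ ⟨hj, hj'⟩]
    · rintro ⟨y, ⟨h1, h2, h3⟩, h4, h5, h6⟩
      refine ⟨⟨h1, ?_⟩, ⟨?_, h5⟩, fun j hj hj' => ?_⟩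
      · rw [← h6 a hac had, ← h6 b hbc hbd, h2]
      · rw [h3 c hac.symm hbc.symm, h3 d had.symm hbd.symm, h4]
      · rw [h3 j hj.1 hj.2, h6 j hj'.1 hj'.2]
  · rintro x y y' z ⟨-, -, h3⟩ ⟨-, -, h6⟩ ⟨-, -, h3'⟩ ⟨-, -, h6'⟩
    refine eq_of_forall_digit fun j => ?_
    by_cases hj : j ≠ a ∧ j ≠ b
    · rw [← h3 j hj.1 hj.2, h3' j hj.1 hj.2]
    · have : j ≠ c ∧ j ≠ d := by
        omega
      rw [h6 j this.1 this.2, h6' j this.1 this.2]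

theorem pairRel_comm (hp : 0 < p) (ha : a < n) (hb : b < n) (hc : c < n) (hd : d < n)
    (hab : a ≠ b) (hcd : c ≠ d) (hac : a ≠ c) (had : a ≠ d) (hbc : b ≠ c) (hbd : b ≠ d) :
    ind R (pairRel p n a b) * ind R (pairRel p n c d) =
      ind R (pairRel p n c d) * ind R (pairRel p n a b) := by
  rw [pairRel_mul_of_disjoint hp ha hb hab hac had hbc hbd,
    pairRel_mul_of_disjoint hp hc hd hcd hac.symm hbc.symm had.symm hbd.symm]
  congr 1
  funext x z
  rw [eq_iff_iff, and_left_comm]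
  exact and_congr_right fun _ => and_congr_right fun _ =>
    forall_congr' fun _ => ⟨fun h h1 h2 => h h2 h1, fun h h1 h2 => h h2 h1⟩

theorem pairRel_braid (hp : 0 < p) (ha : a < n) (hb : b < n) (hab : a ≠ b)
    (hac : a ≠ c) (hbc : b ≠ c) :
    ind R (pairRel p n a b) * ind R (pairRel p n b c) * ind R (pairRel p n a b) =
      ind R (pairRel p n a b) := by
  rw [ind_mul_ind (t := fun x z => ∃ y, pairRel p n a b x y ∧ pairRel p n b c y z)
    (fun _ _ => Iff.rfl)]
  · refine ind_mul_ind ?_ ?_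
    · intro x z
      constructor
      · rintro ⟨h1, h2, h3⟩
        have hzc := digit_lt hp z c
        -- One point serves as both intermediate points: the label at `c` is copied to `a` and `b`.
        obtain ⟨y, hy1, hy2, hy3⟩ := exists_digit_eq_of_ite x ha hb hab hzc hzc
        refine ⟨y, ⟨y, ⟨h1, hy1.trans hy2.symm, fun j hj hj' => (hy3 j hj hj').symm⟩, ?_, ?_,
          fun _ _ _ => rfl⟩, hy1.trans hy2.symm, h2, fun j hj hj' => ?_⟩
        · rw [hy2, hy3 c hac.symm hbc.symm, h3 c hac.symm hbc.symm]
        · rw [hy2, hy3 c hac.symm hbc.symm, h3 c hac.symm hbc.symm]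
        · rw [hy3 j hj hj', h3 j hj hj']
      · rintro ⟨y, ⟨w, ⟨h1, h2, h3⟩, h4, h5, h6⟩, h7, h8, h9⟩
        refine ⟨h1, h8, fun j hj hj' => ?_⟩
        rw [h3 j hj hj', ← h9 j hj hj']
        by_cases hjc : j = c
        · rw [hjc, ← h4, ← h2, h6 a hab hac, h7, h5]
        · exact h6 j hj' hjc
    · rintro x y y' z ⟨w, -, -, h5, -⟩ ⟨h7, -, h9⟩ ⟨w', -, -, h5', -⟩ ⟨h7', -, h9'⟩
      have hbb : digit p y b = digit p y' b := by
        rw [h5, h5', h9 c hac.symm hbc.symm, h9' c hac.symm hbc.symm]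
      refine eq_of_forall_digit fun j => ?_
      by_cases hja : j = a
      · rw [hja, h7, h7', hbb]
      by_cases hjb : j = b
      · rw [hjb, hbb]
      rw [h9 j hja hjb, h9' j hja hjb]
  · rintro x y y' z ⟨-, h2, h3⟩ ⟨-, -, h6⟩ ⟨-, h2', h3'⟩ ⟨-, -, h6'⟩
    have haa : digit p y a = digit p y' a := by
      rw [h6 a hab hac, h6' a hab hac]
    refine eq_of_forall_digit fun j => ?_
    by_cases hja : j = a
    · rw [hja, haa]
    by_cases hjb : j = b
    · rw [hjb, ← h2, ← h2', haa]
    rw [← h3 j hja hjb, h3' j hja hjb]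

end

theorem lift_brauerMatrix_rel (K : Type*) [Field K] {n p : ℕ} (hp : 0 < p)
    ⦃x y : FreeAlgebra K (Fin (n - 1))⦄ (h : Rel K n (p : K) x y) :
    FreeAlgebra.lift K (brauerMatrix K p n) x = FreeAlgebra.lift K (brauerMatrix K p n) y := by
  induction h with
  | comm i j hij =>
    have := i.2
    simp only [map_mul, FreeAlgebra.lift_ι_apply, brauerMatrix_eq_ind, cupRel_eq_pairRel]
    exact pairRel_comm hp (by omega) (by omega) (by omega) (by omega) (by omega) (by omega)
      (by omega) (by omega) (by omega) (by omega)
  | braid i j hij =>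
    have := i.2
    have := j.2
    simp only [map_mul, FreeAlgebra.lift_ι_apply, brauerMatrix_eq_ind, cupRel_eq_pairRel]
    rcases hij with hij | hij
    · rw [hij]
      exact pairRel_braid hp (by omega) (by omega) (by omega) (by omega) (by omega)
    -- Reversing both pairs puts the shared position in the place of `b` in `pairRel_braid`.
    · rw [pairRel_swap p n i, pairRel_swap p n j, ← hij]
      exact pairRel_braid hp (by omega) (by omega) (by omega) (by omega) (by omega)
  | sq i =>
    have := i.2
    simp only [map_mul, map_smul, FreeAlgebra.lift_ι_apply, brauerMatrix_eq_ind,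
      cupRel_eq_pairRel]
    exact pairRel_sq hp (by omega) (by omega) (by omega)

theorem existsUnique_brauer (K : Type*) [Field K] {n p : ℕ} (hp : 0 < p) :
    ∃! ρ : Alg K n (p : K) →ₐ[K] Matrix (Fin (p ^ n)) (Fin (p ^ n)) K,
      ∀ i, ρ (gen K n (p : K) i) = brauerMatrix K p n i := by
  refine ⟨RingQuot.liftAlgHom K ⟨FreeAlgebra.lift K (brauerMatrix K p n),
    lift_brauerMatrix_rel K hp⟩, fun i => ?_, fun ρ hρ => ?_⟩
  · simp [gen]
  · refine RingQuot.ringQuot_ext' K _ _ (FreeAlgebra.hom_ext (funext fun i => ?_))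
    simpa [gen] using hρ i

theorem normalMatrix_eq_ind (K : Type*) [Field K] {n p : ℕ} (hn : 0 < n) (hp : 0 < p)
    (k : NormalSeq n) :
    normalMatrix K p k = ind K (MatchRel p n (extend k.1) (n - 1)) := by
  have h := (represents_natWord K hp k.isNormal.1 (show n - 1 + 1 ≤ n by omega)).2
  rw [← map_val_normalWord, List.map_map] at h
  have e : (fun i : Fin (n - 1) => relOf (brauerMatrix K p n i)) =
      (fun i => ({q | cupRel p n i q.1 q.2} : SetRel (Fin (p ^ n)) (Fin (p ^ n)))) ∘ Fin.val := by
    funext i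
    rw [brauerMatrix_eq_ind, relOf_ind]
    rfl
  ext x y
  rw [normalMatrix, e, h]
  rfl

theorem map_normalForm_eq_ind (K : Type*) [Field K] {n p : ℕ} (hn : 0 < n) (hp : 0 < p)
    {ρ : Alg K n (p : K) →ₐ[K] Matrix (Fin (p ^ n)) (Fin (p ^ n)) K}
    (hρ : ∀ i, ρ (gen K n (p : K) i) = brauerMatrix K p n i) (k : NormalSeq n) :
    ρ (normalForm K (p : K) k) = ind K (MatchRel p n (extend k.1) (n - 1)) := by
  rw [← (represents_natWord K hp k.isNormal.1 (show n - 1 + 1 ≤ n by omega)).1,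
    ← map_val_normalWord, List.map_map, normalForm, map_list_prod, List.map_map]
  congr 2
  funext i
  simp [hρ, brauerMatrix_eq_ind]

end TemperleyLieb

theorem mainTheorem1 (K : Type*) [Field K] (n p : ℕ) (hn : 2 ≤ n) (hp : 2 ≤ p) :
    -- the Jones normal forms are a basis of the Temperley–Lieb algebra
    (LinearIndependent K
        (fun k : TemperleyLieb.NormalSeq n => TemperleyLieb.normalForm K (p : K) k) ∧
      Submodule.span K (Set.range
        (fun k : TemperleyLieb.NormalSeq n => TemperleyLieb.normalForm K (p : K) k)) = ⊤) ∧
    -- the matrices assigned to them are linearly independent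
    LinearIndependent K
      (fun k : TemperleyLieb.NormalSeq n => TemperleyLieb.normalMatrix K p k) ∧
    -- Brauer's representation exists, is unique, gives these matrices, and is faithful
    (∃! ρ : TemperleyLieb.Alg K n (p : K) →ₐ[K] Matrix (Fin (p ^ n)) (Fin (p ^ n)) K,
      ∀ i, ρ (TemperleyLieb.gen K n (p : K) i) = TemperleyLieb.brauerMatrix K p n i) ∧
    ∀ ρ : TemperleyLieb.Alg K n (p : K) →ₐ[K] Matrix (Fin (p ^ n)) (Fin (p ^ n)) K,
      (∀ i, ρ (TemperleyLieb.gen K n (p : K) i) = TemperleyLieb.brauerMatrix K p n i) →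
        (∀ k, ρ (TemperleyLieb.normalForm K (p : K) k) = TemperleyLieb.normalMatrix K p k) ∧
        Function.Injective ρ := by
  have hn' : 0 < n := by omega
  have hp' : 0 < p := by omega
  have hM : LinearIndependent K
      (fun k : TemperleyLieb.NormalSeq n => TemperleyLieb.normalMatrix K p k) := by
    simp only [TemperleyLieb.normalMatrix_eq_ind K hn' hp']
    exact TemperleyLieb.linearIndependent_matchRel K hn' hp
  have hmap : ∀ ρ : TemperleyLieb.Alg K n (p : K) →ₐ[K] Matrix (Fin (p ^ n)) (Fin (p ^ n)) K,
      (∀ i, ρ (TemperleyLieb.gen K n (p : K) i) = TemperleyLieb.brauerMatrix K p n i) →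
        ∀ k, ρ (TemperleyLieb.normalForm K (p : K) k) = TemperleyLieb.normalMatrix K p k :=
    fun ρ hρ k => by
      rw [TemperleyLieb.map_normalForm_eq_ind K hn' hp' hρ,
        TemperleyLieb.normalMatrix_eq_ind K hn' hp']
  have hex := TemperleyLieb.existsUnique_brauer K (n := n) hp'
  have hN : LinearIndependent K
      (fun k : TemperleyLieb.NormalSeq n => TemperleyLieb.normalForm K (p : K) k) := by
    obtain ⟨ρ, hρ, -⟩ := hex
    -- Independence of the normal forms is pulled back from that of their images.
    refine LinearIndependent.of_comp ρ.toLinearMap ?_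
    have e : ρ.toLinearMap ∘ (fun k : TemperleyLieb.NormalSeq n =>
        TemperleyLieb.normalForm K (p : K) k) = fun k => TemperleyLieb.normalMatrix K p k :=
      funext (hmap ρ hρ)
    rw [e]
    exact hM
  have hS := TemperleyLieb.span_normalForm (K := K) (n := n) (δ := (p : K))
  refine ⟨⟨hN, hS⟩, hM, hex, fun ρ hρ => ⟨hmap ρ hρ, ?_⟩⟩
  refine (injective_iff_map_eq_zero ρ).2 fun v hv => ?_
  obtain ⟨l, rfl⟩ : v ∈ LinearMap.range (Finsupp.linearCombination K
      fun k : TemperleyLieb.NormalSeq n => TemperleyLieb.normalForm K (p : K) k) := by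
    rw [Finsupp.range_linearCombination, hS]
    trivial
  have hl : Finsupp.linearCombination K
      (fun k : TemperleyLieb.NormalSeq n => TemperleyLieb.normalMatrix K p k) l = 0 := by
    rw [← hv, ← AlgHom.toLinearMap_apply, Finsupp.apply_linearCombination]
    congr 2
    funext k
    exact (hmap ρ hρ k).symm
  rw [linearIndependent_iff.1 hM l hl, map_zero]
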